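/- Let $\mathfrak h$ be a complex Hilbert space and let $H$ be a closed symmetric operator in $\mathfrak h$, that is, a closed, densely defined linear operator with $\langle Hu,v\rangle=\langle u,Hv\rangle$ for all $u,v\in\operatorname{dom}H$. Assume that the defect subspaces $N_+=\ker(i-H^*)$ and $N_-=\ker(-i-H^*)$ have finite dimensions $n_+=\dim N_+$ and $n_-=\dim N_-$ (the defect indices of $H$). (i) If $n_+\le n_-$, then $iH$ is the restriction of the infinitesimal generator of a strongly continuous semigroup of isometries: there is a strongly continuous semigroup $(W_t)_{t\ge0}$ of bounded linear operators on $\mathfrak h$ with $\|W_tu\|=\|u\|$ for all $t\ge0$ and $u\in\mathfrak h$ such that every $u\in\operatorname{dom}H$ satisfies $\lim_{t\to0^+}t^{-1}(W_tu-u)=iHu$ in norm. (ii) If $n_+>n_-$, then $iH$ is not the restriction of the infinitesimal generator of any strongly continuous semigroup of isometries in $\mathfrak h$. -/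

import Mathlib

open Filter Topology
open scoped NNReal

/-- A strongly continuous one-parameter semigroup `(W t)_{t ≥ 0}` of bounded linear operators. -/
structure C0Semigroup (E : Type*) [NormedAddCommGroup E] [NormedSpace ℂ E] where
  toFun : ℝ≥0 → E →L[ℂ] E
  map_zero : toFun 0 = ContinuousLinearMap.id ℂ E
  map_add : ∀ s t : ℝ≥0, toFun (s + t) = (toFun s).comp (toFun t)
  strongly_continuous : ∀ x : E, Continuous fun t : ℝ≥0 => toFun t x

namespace C0Semigroup

variable {E : Type*} [NormedAddCommGroup E] [NormedSpace ℂ E]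

/-- `W` consists of isometries: `‖W t x‖ = ‖x‖` for all `t ≥ 0` and all `x`. -/
def IsIsometric (W : C0Semigroup E) : Prop :=
  ∀ (t : ℝ≥0) (x : E), ‖W.toFun t x‖ = ‖x‖

/-- The graph of the infinitesimal generator: all pairs `(x, y)` such that
`(W t x - x) / t → y` in norm as `t → 0+`. -/
def generatorGraph (W : C0Semigroup E) : Submodule ℂ (E × E) where
  carrier := {p | Tendsto (fun t : ℝ≥0 => (((t : ℝ) : ℂ)⁻¹) • (W.toFun t p.1 - p.1))
    (𝓝[>] 0) (𝓝 p.2)}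
  zero_mem' := by simp
  add_mem' := by
    intro p q hp hq
    refine (Tendsto.add hp hq).congr fun t => ?_
    simp only [Prod.fst_add, _root_.map_add, ← smul_add]
    congr 1
    abel
  smul_mem' := by
    intro c p hp
    refine (Tendsto.const_smul hp c).congr fun t => ?_
    simp only [Prod.smul_fst, map_smul, ← smul_sub]
    rw [smul_comm]

/-- The infinitesimal generator of `W`: its domain consists of all `x` for which
`(W t x - x) / t` converges in norm as `t → 0+`, and its value at `x` is this limit. -/
noncomputable def generator (W : C0Semigroup E) : E →ₗ.[ℂ] E :=
  W.generatorGraph.toLinearPMap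

/-- The generator is indeed the operator given by the limit of the difference quotients. -/
theorem mem_graph_generator_iff (W : C0Semigroup E) (x y : E) :
    (x, y) ∈ W.generator.graph ↔
      Tendsto (fun t : ℝ≥0 => (((t : ℝ) : ℂ)⁻¹) • (W.toFun t x - x)) (𝓝[>] 0) (𝓝 y) := by
  have h : W.generator.graph = W.generatorGraph := by
    refine Submodule.toLinearPMap_graph_eq _ ?_
    rintro ⟨a, b⟩ hp (ha : a = 0)
    subst ha
    have hp' : Tendsto (fun t : ℝ≥0 => (((t : ℝ) : ℂ)⁻¹) • (W.toFun t (0 : E) - 0))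
      (𝓝[>] 0) (𝓝 b) := hp
    simp only [_root_.map_zero, sub_zero, smul_zero] at hp'
    exact (tendsto_nhds_unique hp' tendsto_const_nhds)
  rw [h]
  rfl

end C0Semigroup

namespace UnboundedOperator

variable {E : Type*} [NormedAddCommGroup E] [InnerProductSpace ℂ E]

/-- A symmetric operator: densely defined, with `⟪H u, v⟫ = ⟪u, H v⟫` for all `u, v ∈ dom H`. -/
def IsSymmetric (H : E →ₗ.[ℂ] E) : Prop :=
  Dense (H.domain : Set E) ∧ H.IsFormalAdjoint H

variable [CompleteSpace E]

/-- The eigenspace `ker (z - H*)`, as a subspace of the whole Hilbert space. -/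
noncomputable def adjointEigenspace (H : E →ₗ.[ℂ] E) (z : ℂ) : Submodule ℂ E :=
  (LinearMap.ker (z • H.adjoint.domain.subtype - H.adjoint.toFun)).map H.adjoint.domain.subtype

/-- The defect subspace `N₊ = ker (i - H*)`. -/
noncomputable def defectSpacePlus (H : E →ₗ.[ℂ] E) : Submodule ℂ E :=
  adjointEigenspace H Complex.I

/-- The defect subspace `N₋ = ker (-i - H*)`. -/
noncomputable def defectSpaceMinus (H : E →ₗ.[ℂ] E) : Submodule ℂ E :=
  adjointEigenspace H (-Complex.I)

/-- `H` has finite defect indices `(n₊, n₋)`: the spaces `N₊` and `N₋` are finite-dimensional,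
of dimension `n₊` and `n₋` (the rank is a cardinal, so no junk value is involved). -/
def HasFiniteDefectIndices (H : E →ₗ.[ℂ] E) (nPlus nMinus : ℕ) : Prop :=
  Module.rank ℂ (defectSpacePlus H) = nPlus ∧ Module.rank ℂ (defectSpaceMinus H) = nMinus

end UnboundedOperator

/-! Everything passes through the Cayley transform. With A = iH, symmetry says Re ⟪u, Au⟫ = 0, so ‖u
- Au‖ = ‖u + Au‖ and u - Au ↦ u + Au is an isometry from ran(1 - A) onto ran(1 + A). The orthogonal
complements of these ranges are N₊ and N₋.

If n₊ ≤ n₋, an isometry N₊ → N₋ completes it to an isometry V of the whole space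
(`exists_isometry_of_orthogonal`); ran(1 - A) is closed because H is. Since (1 + V)(u - Au) = 2u,
the range of 1 + V is dense, and `exists_isIsometric_of_cogenerator` produces a semigroup whose
generator extends (V - 1)(V + 1)⁻¹, hence A. That semigroup is the limit of exp(tBₙ), where Bₙ =
(rₙV - 1)(rₙV + 1)⁻¹ is bounded and dissipative and rₙ → 1.

Conversely, the generator of an isometric semigroup is skew and 1 minus it is onto, so its Cayley
transform is an everywhere defined isometry extending that of A. It maps N₊ injectively into N₋,
whence n₊ ≤ n₋. -/

/-! ### Exponentials of bounded dissipative operators. -/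

section DissipativeExponential

variable {E : Type*} [NormedAddCommGroup E] [InnerProductSpace ℂ E]

/-- A bounded operator `B` is dissipative if `Re ⟪x, B x⟫ ≤ 0` for all `x`. -/
def ContinuousLinearMap.IsDissipative (B : E →L[ℂ] E) : Prop :=
  ∀ x, (inner ℂ x (B x)).re ≤ 0

theorem hasDerivAt_norm_sq_complex {f : ℝ → E} {f' : E} {t : ℝ} (hf : HasDerivAt f f' t) :
    HasDerivAt (fun s => ‖f s‖ ^ 2) (2 * (inner ℂ (f t) f').re) t := by
  have h := Complex.reCLM.hasFDerivAt.comp_hasDerivAt t (hf.inner ℂ hf)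
  have e : (fun s => ‖f s‖ ^ 2) = (Complex.reCLM ∘ fun s => inner ℂ (f s) (f s)) := by
    ext s
    simp [inner_self_eq_norm_sq_to_K, ← Complex.ofReal_pow]
  rw [e]
  refine h.congr_deriv ?_
  rw [Complex.reCLM_apply, Complex.add_re, ← inner_conj_symm f' (f t), Complex.conj_re]
  ring

variable [CompleteSpace E]

theorem hasDerivAt_exp_smul_apply (B : E →L[ℂ] E) (x : E) (t : ℝ) :
    HasDerivAt (fun s : ℝ => NormedSpace.exp (s • B) x) (NormedSpace.exp (t • B) (B x)) t := by
  have h := hasDerivAt_exp_smul_const (𝕂 := ℝ) B t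
  exact ((ContinuousLinearMap.apply ℂ E x).restrictScalars ℝ).hasFDerivAt.comp_hasDerivAt t h

theorem exp_clm_add_of_commute {B C : E →L[ℂ] E} (h : Commute B C) :
    NormedSpace.exp (B + C) = NormedSpace.exp B * NormedSpace.exp C :=
  letI : NormedAlgebra ℚ (E →L[ℂ] E) := .restrictScalars ℚ ℂ _
  NormedSpace.exp_add_of_commute h

theorem exp_smul_apply_comm (B : E →L[ℂ] E) (x : E) (t : ℝ) :
    NormedSpace.exp (t • B) (B x) = B (NormedSpace.exp (t • B) x) := by
  have h : Commute (NormedSpace.exp (t • B)) B :=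
    ((Commute.refl B).smul_left t).exp_left
  exact DFunLike.congr_fun h.eq x

theorem exp_add_smul_apply (B : E →L[ℂ] E) (s t : ℝ) (x : E) :
    NormedSpace.exp ((s + t) • B) x = NormedSpace.exp (s • B) (NormedSpace.exp (t • B) x) := by
  rw [add_smul, exp_clm_add_of_commute (((Commute.refl B).smul_left s).smul_right t)]
  rfl

theorem hasDerivAt_norm_sq_exp_smul (B : E →L[ℂ] E) (x : E) (t : ℝ) :
    HasDerivAt (fun s : ℝ => ‖NormedSpace.exp (s • B) x‖ ^ 2)
      (2 * (inner ℂ (NormedSpace.exp (t • B) x) (B (NormedSpace.exp (t • B) x))).re) t := by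
  rw [← exp_smul_apply_comm]
  exact hasDerivAt_norm_sq_complex (hasDerivAt_exp_smul_apply B x t)

namespace ContinuousLinearMap.IsDissipative

theorem norm_exp_smul_le {B : E →L[ℂ] E} (hB : B.IsDissipative) {t : ℝ} (ht : 0 ≤ t) (x : E) :
    ‖NormedSpace.exp (t • B) x‖ ≤ ‖x‖ := by
  have h : Antitone (fun s : ℝ => ‖NormedSpace.exp (s • B) x‖ ^ 2) := by
    refine antitone_of_deriv_nonpos
      (fun s => (hasDerivAt_norm_sq_exp_smul B x s).differentiableAt) fun s => ?_
    rw [(hasDerivAt_norm_sq_exp_smul B x s).deriv]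
    linarith [hB (NormedSpace.exp (s • B) x)]
  have h0 := h ht
  simp only [zero_smul, NormedSpace.exp_zero, one_apply_eq_self] at h0
  exact (sq_le_sq₀ (norm_nonneg _) (norm_nonneg _)).1 h0

/-- Interpolate along s ↦ exp((t - s)B) exp(sC) x. Commutativity rewrites this as exp(tB) exp(s(C -
B)) x, whose derivative is two contractions applied to (C - B)x. -/
theorem norm_exp_smul_sub_exp_smul_le {B C : E →L[ℂ] E} (hB : B.IsDissipative)
    (hC : C.IsDissipative) (hBC : Commute B C) {t : ℝ} (ht : 0 ≤ t) (x : E) :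
    ‖NormedSpace.exp (t • C) x - NormedSpace.exp (t • B) x‖ ≤ t * ‖C x - B x‖ := by
  have hcomm : Commute B (C - B) := hBC.sub_right (Commute.refl B)
  have key : ∀ s : ℝ, NormedSpace.exp (t • B) * NormedSpace.exp (s • (C - B)) =
      NormedSpace.exp ((t - s) • B) * NormedSpace.exp (s • C) := by
    intro s
    rw [← exp_clm_add_of_commute ((hcomm.smul_left t).smul_right s),
      ← exp_clm_add_of_commute ((hBC.smul_left _).smul_right s)]
    congr 1
    module
  have hd : ∀ s ∈ Set.Icc (0 : ℝ) t,
      HasDerivWithinAt (fun s : ℝ => NormedSpace.exp (t • B) (NormedSpace.exp (s • (C - B)) x))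
        (NormedSpace.exp (t • B) (NormedSpace.exp (s • (C - B)) ((C - B) x))) (Set.Icc 0 t) s :=
    fun s _ => (((NormedSpace.exp (t • B)).restrictScalars ℝ).hasFDerivAt.comp_hasDerivAt s
      (hasDerivAt_exp_smul_apply (C - B) x s)).hasDerivWithinAt
  have hle : ∀ s ∈ Set.Ico (0 : ℝ) t,
      ‖NormedSpace.exp (t • B) (NormedSpace.exp (s • (C - B)) ((C - B) x))‖ ≤ ‖C x - B x‖ := by
    intro s hs
    have := DFunLike.congr_fun (key s) ((C - B) x)
    simp only [mul_apply_eq_comp] at this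
    rw [this]
    exact (hB.norm_exp_smul_le (by linarith [hs.2]) _).trans (hC.norm_exp_smul_le hs.1 _)
  have h := norm_image_sub_le_of_norm_deriv_le_segment' hd hle t ⟨ht, le_rfl⟩
  have h1 := DFunLike.congr_fun (key t) x
  simp only [mul_apply_eq_comp, sub_self, zero_smul, NormedSpace.exp_zero,
    one_apply_eq_self] at h1
  rw [h1] at h
  simpa [mul_comm] using h

theorem norm_exp_smul_sub_self_le {B : E →L[ℂ] E} (hB : B.IsDissipative) {t : ℝ} (ht : 0 ≤ t)
    (x : E) : ‖NormedSpace.exp (t • B) x - x‖ ≤ t * ‖B x‖ := by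
  have h0 : (0 : E →L[ℂ] E).IsDissipative := fun x => by simp
  simpa using h0.norm_exp_smul_sub_exp_smul_le hB (Commute.zero_left B) ht x

/-- Quantitative differentiability at 0, uniform over approximants B. In the application y is the
limit of Bx and may lie outside the limit domain, where By is uncontrolled; hence the substitute z.
-/
theorem norm_exp_smul_sub_sub_smul_le {B : E →L[ℂ] E} (hB : B.IsDissipative) {t : ℝ} (ht : 0 ≤ t)
    (x y z : E) : ‖NormedSpace.exp (t • B) x - x - t • y‖ ≤
      t * (‖B x - y‖ + 2 * ‖y - z‖ + t * ‖B z‖) := by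
  have hd : ∀ s ∈ Set.Icc (0 : ℝ) t,
      HasDerivWithinAt (fun s : ℝ => NormedSpace.exp (s • B) x - s • y)
        (NormedSpace.exp (s • B) (B x) - y) (Set.Icc 0 t) s := fun s _ => by
    simpa using ((hasDerivAt_exp_smul_apply B x s).fun_sub
      ((hasDerivAt_id' s).smul_const y)).hasDerivWithinAt
  have hle : ∀ s ∈ Set.Ico (0 : ℝ) t, ‖NormedSpace.exp (s • B) (B x) - y‖ ≤
      ‖B x - y‖ + 2 * ‖y - z‖ + t * ‖B z‖ := by
    intro s hs
    have e : NormedSpace.exp (s • B) (B x) - y = NormedSpace.exp (s • B) (B x - y) +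
        NormedSpace.exp (s • B) (y - z) + (NormedSpace.exp (s • B) z - z) - (y - z) := by
      simp only [map_sub]; abel
    have h1 := hB.norm_exp_smul_le hs.1 (B x - y)
    have h2 := hB.norm_exp_smul_le hs.1 (y - z)
    have h3 := hB.norm_exp_smul_sub_self_le hs.1 z
    have h4 : s * ‖B z‖ ≤ t * ‖B z‖ := mul_le_mul_of_nonneg_right hs.2.le (norm_nonneg _)
    rw [e]
    refine (norm_sub_le _ _).trans ?_
    have := norm_add₃_le (a := NormedSpace.exp (s • B) (B x - y))
      (b := NormedSpace.exp (s • B) (y - z)) (c := NormedSpace.exp (s • B) z - z)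
    linarith
  have h := norm_image_sub_le_of_norm_deriv_le_segment' hd hle t ⟨ht, le_rfl⟩
  have e : NormedSpace.exp (t • B) x - t • y - (NormedSpace.exp ((0 : ℝ) • B) x - (0 : ℝ) • y) =
      NormedSpace.exp (t • B) x - x - t • y := by
    simp only [zero_smul, NormedSpace.exp_zero, one_apply_eq_self]; abel
  rw [e] at h
  simpa [mul_comm] using h

end ContinuousLinearMap.IsDissipative

end DissipativeExponential

/-! ### Limits of exponentials: generation of contraction semigroups. -/

section Generation

/-- Pointwise Cauchy on a dense set and equi-Lipschitz implies pointwise Cauchy. -/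
theorem cauchySeq_apply_of_dense {E F : Type*} [NormedAddCommGroup E] [NormedAddCommGroup F]
    (U : ℕ → E → F) (hU : ∀ n x y, ‖U n x - U n y‖ ≤ ‖x - y‖) {D : Set E} (hD : Dense D)
    (hC : ∀ x ∈ D, CauchySeq fun n => U n x) (x : E) : CauchySeq fun n => U n x := by
  rw [Metric.cauchySeq_iff]
  intro ε hε
  obtain ⟨y, hy, hxy⟩ := hD.exists_dist_lt x (ε := ε / 3) (by positivity)
  obtain ⟨N, hN⟩ := Metric.cauchySeq_iff.1 (hC y hy) (ε / 3) (by positivity)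
  refine ⟨N, fun m hm n hn => ?_⟩
  have h1 := hN m hm n hn
  have h2 := hU m x y
  have h3 := hU n y x
  rw [dist_eq_norm] at hxy
  rw [← dist_eq_norm] at h2 h3
  rw [norm_sub_rev y x] at h3
  calc dist (U m x) (U n x)
      ≤ dist (U m x) (U m y) + dist (U m y) (U n y) + dist (U n y) (U n x) := dist_triangle4 _ _ _ _
    _ < ε := by linarith

/-- If operators of norm at most one converge to zero pointwise on a dense set, they converge to
zero pointwise everywhere. -/
theorem tendsto_apply_zero_of_dense {E F : Type*} [NormedAddCommGroup E] [NormedAddCommGroup F]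
    (U : ℕ → E → F) (hU : ∀ n x y, ‖U n x - U n y‖ ≤ ‖x - y‖) {D : Set E} (hD : Dense D)
    (hC : ∀ x ∈ D, Tendsto (fun n => U n x) atTop (𝓝 0)) (x : E) :
    Tendsto (fun n => U n x) atTop (𝓝 0) := by
  rw [Metric.tendsto_atTop]
  intro ε hε
  obtain ⟨y, hy, hxy⟩ := hD.exists_dist_lt x (ε := ε / 2) (by positivity)
  obtain ⟨N, hN⟩ := Metric.tendsto_atTop.1 (hC y hy) (ε / 2) (by positivity)
  refine ⟨N, fun n hn => ?_⟩
  have h2 := hU n x y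
  rw [dist_eq_norm] at hxy
  rw [← dist_eq_norm] at h2
  linarith [hN n hn, dist_triangle (U n x) (U n y) 0]

variable {E : Type*} [NormedAddCommGroup E] [InnerProductSpace ℂ E] [CompleteSpace E]

/-- Bounded dissipative commuting operators converging on a dense set give, in the limit, a
contraction semigroup whose generator extends the limit operator. -/
theorem exists_C0Semigroup_of_tendsto (B : ℕ → E →L[ℂ] E) (hB : ∀ n, (B n).IsDissipative)
    (hcomm : ∀ m n, Commute (B m) (B n)) (G : Submodule ℂ (E × E))
    (hG : Dense {x : E | ∃ y, (x, y) ∈ G})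
    (hconv : ∀ x y, (x, y) ∈ G → Tendsto (fun n => B n x) atTop (𝓝 y)) :
    ∃ W : C0Semigroup E, (∀ (t : ℝ≥0) (x : E),
      Tendsto (fun n => NormedSpace.exp ((t : ℝ) • B n) x) atTop (𝓝 (W.toFun t x))) ∧
      G ≤ W.generatorGraph := by
  have hcontr : ∀ (t : ℝ≥0) n (x y : E), ‖NormedSpace.exp ((t : ℝ) • B n) x -
      NormedSpace.exp ((t : ℝ) • B n) y‖ ≤ ‖x - y‖ := fun t n x y => by
    rw [← map_sub]
    exact (hB n).norm_exp_smul_le t.2 _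
  have hlim : ∀ (t : ℝ≥0) (x : E), ∃ z,
      Tendsto (fun n => NormedSpace.exp ((t : ℝ) • B n) x) atTop (𝓝 z) := by
    intro t x
    apply cauchySeq_tendsto_of_complete
    refine cauchySeq_apply_of_dense (fun n x => NormedSpace.exp ((t : ℝ) • B n) x)
      (hcontr t) hG ?_ x
    rintro x ⟨y, hxy⟩
    have hc := (hconv x y hxy).cauchySeq
    rw [Metric.cauchySeq_iff] at hc ⊢
    intro ε hε
    -- The exponentials differ by at most t‖Bₘx - Bₙx‖; t + 1 also covers t = 0.
    obtain ⟨N, hN⟩ := hc (ε / (t + 1)) (by positivity)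
    refine ⟨N, fun m hm n hn => ?_⟩
    have h1 := (hB n).norm_exp_smul_sub_exp_smul_le (hB m) (hcomm n m) t.2 x
    have h2 := hN m hm n hn
    rw [dist_eq_norm] at h2 ⊢
    rw [lt_div_iff₀ (by positivity)] at h2
    simp only [NNReal.val_eq_coe] at h1
    nlinarith [norm_nonneg (B m x - B n x)]
  choose w hw using hlim
  have hwle : ∀ t x, ‖w t x‖ ≤ ‖x‖ := fun t x =>
    le_of_tendsto (hw t x).norm (Eventually.of_forall fun n => (hB n).norm_exp_smul_le t.2 x)
  have hadd : ∀ t x y, w t (x + y) = w t x + w t y := fun t x y =>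
    tendsto_nhds_unique (hw t (x + y)) (by simpa using (hw t x).add (hw t y))
  have hsmul : ∀ t (c : ℂ) x, w t (c • x) = c • w t x := fun t c x =>
    tendsto_nhds_unique (hw t (c • x)) (by simpa using (hw t x).const_smul c)
  let L : ℝ≥0 → E →L[ℂ] E := fun t =>
    LinearMap.mkContinuous ⟨⟨w t, hadd t⟩, hsmul t⟩ 1 (fun x => by simpa using hwle t x)
  have hL : ∀ t x, L t x = w t x := fun _ _ => rfl
  have hL1 : ∀ t x, ‖L t x‖ ≤ ‖x‖ := hwle
  have hsg : ∀ s t x, w (s + t) x = w s (w t x) := by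
    intro s t x
    refine tendsto_nhds_unique (hw (s + t) x) ?_
    -- Uniform contractivity allows the inner limit to be taken under the varying outer operator.
    have h1 : Tendsto (fun n => NormedSpace.exp ((s : ℝ) • B n) (NormedSpace.exp ((t : ℝ) • B n) x)
        - NormedSpace.exp ((s : ℝ) • B n) (w t x)) atTop (𝓝 0) := by
      refine squeeze_zero_norm (fun n => hcontr s n _ _) ?_
      simpa using ((hw t x).sub_const (w t x)).norm
    have h2 := h1.add (hw s (w t x))
    simp only [sub_add_cancel, zero_add] at h2
    simpa only [NNReal.coe_add, exp_add_smul_apply] using h2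
  have hest : ∀ (t : ℝ≥0) x y z z', (x, y) ∈ G → (z, z') ∈ G →
      ‖w t x - x - (t : ℝ) • y‖ ≤ t * (2 * ‖y - z‖ + t * ‖z'‖) := by
    intro t x y z z' hxy hz
    have h1 : Tendsto (fun n => ‖NormedSpace.exp ((t : ℝ) • B n) x - x - (t : ℝ) • y‖) atTop
        (𝓝 ‖w t x - x - (t : ℝ) • y‖) := (((hw t x).sub_const x).sub_const _).norm
    have h2 : Tendsto (fun n => (t : ℝ) * (‖B n x - y‖ + 2 * ‖y - z‖ + t * ‖B n z‖)) atTop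
        (𝓝 (t * (‖y - y‖ + 2 * ‖y - z‖ + t * ‖z'‖))) :=
      (((((hconv x y hxy).sub_const y).norm).add_const _).add
        ((hconv z z' hz).norm.const_mul _)).const_mul _
    simpa using le_of_tendsto_of_tendsto' h1 h2
      fun n => (hB n).norm_exp_smul_sub_sub_smul_le t.2 x y z
  have hlip : ∀ (t : ℝ≥0) x y, (x, y) ∈ G → ‖w t x - x‖ ≤ t * ‖y‖ := by
    intro t x y hxy
    exact le_of_tendsto_of_tendsto' ((hw t x).sub_const x).norm
      ((hconv x y hxy).norm.const_mul _) fun n => (hB n).norm_exp_smul_sub_self_le t.2 x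
  have hlip2 : ∀ (s t : ℝ≥0) x y, (x, y) ∈ G → ‖w s x - w t x‖ ≤ dist s t * ‖y‖ := by
    have aux : ∀ (s t : ℝ≥0) x y, t ≤ s → (x, y) ∈ G → ‖w s x - w t x‖ ≤ dist s t * ‖y‖ := by
      intro s t x y hts hxy
      obtain ⟨r, rfl⟩ := exists_add_of_le hts
      have e : w (t + r) x - w t x = L t (w r x - x) := by
        rw [map_sub, hL, hL, hsg]
      rw [e]
      refine (hL1 _ _).trans ((hlip r x y hxy).trans ?_)
      simp [NNReal.dist_eq]
    intro s t x y hxy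
    rcases le_total t s with h | h
    · exact aux s t x y h hxy
    · rw [norm_sub_rev, dist_comm]
      exact aux t s x y h hxy
  have hcont : ∀ x, Continuous fun t => w t x := by
    intro x
    rw [Metric.continuous_iff]
    intro t ε hε
    obtain ⟨z, ⟨z', hz⟩, hxz⟩ := hG.exists_dist_lt x (ε := ε / 3) (by positivity)
    refine ⟨ε / 3 / (‖z'‖ + 1), by positivity, fun s hs => ?_⟩
    rw [lt_div_iff₀ (by positivity)] at hs
    rw [dist_eq_norm] at hxz ⊢
    have e : w s x - w t x = L s (x - z) + (w s z - w t z) - L t (x - z) := by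
      simp only [map_sub (L _)]; simp only [hL]; abel
    have h1 := hL1 s (x - z)
    have h2 := hL1 t (x - z)
    have h3 := hlip2 s t z z' hz
    have h4 := norm_sub_le (L s (x - z) + (w s z - w t z)) (L t (x - z))
    have h5 := norm_add_le (L s (x - z)) (w s z - w t z)
    rw [e]
    nlinarith [dist_nonneg (x := s) (y := t)]
  refine ⟨⟨L, ?_, ?_, hcont⟩, hw, ?_⟩
  · ext x
    exact tendsto_nhds_unique (hw 0 x) (by simp)
  · intro s t
    ext x
    exact hsg s t x
  · rintro ⟨x, y⟩ hxy
    change Tendsto (fun t : ℝ≥0 => (((t : ℝ) : ℂ)⁻¹) • (w t x - x)) (𝓝[>] 0) (𝓝 y)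
    rw [Metric.tendsto_nhdsWithin_nhds]
    intro ε hε
    -- Dividing `hest` by t leaves 2‖y - z‖ + t‖z'‖, which is below 2ε/3 + ε/3.
    obtain ⟨z, ⟨z', hz⟩, hyz⟩ := hG.exists_dist_lt y (ε := ε / 3) (by positivity)
    refine ⟨ε / 3 / (‖z'‖ + 1), by positivity, fun t ht htd => ?_⟩
    have ht0 : (0 : ℝ) < t := ht
    rw [lt_div_iff₀ (by positivity), NNReal.dist_eq, NNReal.coe_zero, sub_zero,
      abs_of_pos ht0] at htd
    have h := hest t x y z z' hxy hz
    have e : (((t : ℝ) : ℂ)⁻¹) • (w t x - x) - y =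
        (((t : ℝ) : ℂ)⁻¹) • (w t x - x - (t : ℝ) • y) := by
      have : ((t : ℝ) : ℂ) ≠ 0 := by exact_mod_cast ht0.ne'
      rw [smul_sub _ _ ((t : ℝ) • y), ← Complex.coe_smul, inv_smul_smul₀ this]
    rw [dist_eq_norm] at hyz ⊢
    rw [e, norm_smul, norm_inv, Complex.norm_real, Real.norm_of_nonneg ht0.le,
      inv_mul_lt_iff₀ ht0]
    refine h.trans_lt (mul_lt_mul_of_pos_left ?_ ht0)
    nlinarith

end Generation

/-! ### From an isometric cogenerator to the semigroup. -/

section Cogenerator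

variable {E : Type*} [NormedAddCommGroup E] [InnerProductSpace ℂ E]

theorem re_inner_add_sub (a b : E) :
    (inner ℂ (a + b) (a - b)).re = ‖a‖ ^ 2 - ‖b‖ ^ 2 := by
  have h := inner_re_symm (𝕜 := ℂ) a b
  have ha := inner_self_eq_norm_sq (𝕜 := ℂ) a
  have hb := inner_self_eq_norm_sq (𝕜 := ℂ) b
  simp only [RCLike.re_to_complex] at h ha hb
  rw [inner_add_left, inner_sub_right, inner_sub_right]
  simp only [Complex.add_re, Complex.sub_re]
  linarith

variable [CompleteSpace E]

/-- The regularised cogenerator `(r V - 1) (r V + 1)⁻¹ = 1 - 2 (1 + r V)⁻¹`. -/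
noncomputable def regularisedCayley (V : E →L[ℂ] E) (r : ℝ) : E →L[ℂ] E :=
  1 - 2 * Ring.inverse (1 + r • V)

omit [CompleteSpace E] in
theorem regularisedCayley_apply (V : E →L[ℂ] E) (r : ℝ) (x : E) :
    regularisedCayley V r x = x - (2 : ℝ) • Ring.inverse (1 + r • V) x := by
  simp [regularisedCayley, two_mul, two_smul]

variable {V : E →L[ℂ] E} (hV : ∀ x, ‖V x‖ = ‖x‖)
include hV

theorem isUnit_one_add_smul_of_isometry {r : ℝ} (h0 : 0 ≤ r) (h1 : r < 1) :
    IsUnit (1 + r • V) := by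
  have h : ‖-(r • V)‖ < 1 := by
    rw [norm_neg, norm_smul, Real.norm_of_nonneg h0]
    have : ‖V‖ ≤ 1 := V.opNorm_le_bound zero_le_one fun x => by rw [hV, one_mul]
    nlinarith [norm_nonneg V]
  simpa using isUnit_one_sub_of_norm_lt_one h

theorem add_smul_inverse_apply {r : ℝ} (h0 : 0 ≤ r) (h1 : r < 1) (x : E) :
    Ring.inverse (1 + r • V) x + r • V (Ring.inverse (1 + r • V) x) = x := by
  have h := DFunLike.congr_fun
    (Ring.mul_inverse_cancel _ (isUnit_one_add_smul_of_isometry hV h0 h1)) x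
  simpa using h

theorem inverse_apply_add_smul {r : ℝ} (h0 : 0 ≤ r) (h1 : r < 1) (x : E) :
    Ring.inverse (1 + r • V) (x + r • V x) = x := by
  have h := DFunLike.congr_fun
    (Ring.inverse_mul_cancel _ (isUnit_one_add_smul_of_isometry hV h0 h1)) x
  simpa using h

/-- With w = (1 + rV)⁻¹x one has x = rVw + w and Bx = rVw - w, so the real part is ‖rVw‖² - ‖w‖².
The exact value gives dissipativity and also measures the loss of norm, which vanishes as r → 1. -/
theorem re_inner_regularisedCayley {r : ℝ} (h0 : 0 ≤ r) (h1 : r < 1) (x : E) :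
    (inner ℂ x (regularisedCayley V r x)).re =
      (r ^ 2 - 1) * ‖Ring.inverse (1 + r • V) x‖ ^ 2 := by
  have hw := add_smul_inverse_apply hV h0 h1 x
  set w := Ring.inverse (1 + r • V) x with hwd
  have e : regularisedCayley V r x = r • V w - w := by
    rw [regularisedCayley_apply, ← hwd]
    nth_rewrite 1 [← hw]
    module
  rw [e]
  nth_rewrite 1 [← hw]
  rw [add_comm, re_inner_add_sub, norm_smul, hV, Real.norm_of_nonneg h0]
  ring

theorem regularisedCayley_isDissipative {r : ℝ} (h0 : 0 ≤ r) (h1 : r < 1) :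
    (regularisedCayley V r).IsDissipative := fun x => by
  rw [re_inner_regularisedCayley hV h0 h1]
  exact mul_nonpos_of_nonpos_of_nonneg (by nlinarith) (by positivity)

theorem norm_one_sub_smul_inverse_le {r : ℝ} (h0 : 0 ≤ r) (h1 : r < 1) (x : E) :
    ‖(1 - r) • Ring.inverse (1 + r • V) x‖ ≤ ‖x‖ := by
  have hw := add_smul_inverse_apply hV h0 h1 x
  set w := Ring.inverse (1 + r • V) x
  have h := norm_sub_norm_le w (-(r • V w))
  rw [sub_neg_eq_add, hw, norm_neg, norm_smul, hV, Real.norm_of_nonneg h0] at h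
  rw [norm_smul, Real.norm_of_nonneg (by linarith)]
  linarith

omit hV [CompleteSpace E] in
theorem commute_inverse_one_add_smul (V : E →L[ℂ] E) (r s : ℝ) :
    Commute (Ring.inverse (1 + r • V)) (Ring.inverse (1 + s • V)) := by
  refine Commute.ringInverse_ringInverse ?_
  exact ((Commute.one_left _).add_left
    (((Commute.one_right V).add_right ((Commute.refl V).smul_right s)).smul_left r))

omit hV [CompleteSpace E] in
theorem commute_regularisedCayley (V : E →L[ℂ] E) (r s : ℝ) :
    Commute (regularisedCayley V r) (regularisedCayley V s) := by
  have h := commute_inverse_one_add_smul V r s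
  have h2 : ∀ A : E →L[ℂ] E, Commute 2 A := fun A => Nat.cast_ofNat (R := E →L[ℂ] E) (n := 2) ▸
    Nat.cast_commute 2 A
  exact ((Commute.one_left _)).sub_left ((Commute.one_right _).sub_right
    ((h2 _).mul_left ((h2 _).symm.mul_right h)))

/-- Follows from y + Vy = (1 + rV)y + (1 - r)Vy. Thus (1 + rV)⁻¹ stays bounded on vectors y + Vy as
r → 1, although its norm may blow up. -/
theorem inverse_apply_add {r : ℝ} (h0 : 0 ≤ r) (h1 : r < 1) (y : E) :
    Ring.inverse (1 + r • V) (y + V y) = y + (1 - r) • Ring.inverse (1 + r • V) (V y) := by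
  have e : y + V y = (y + r • V y) + (1 - r) • V y := by module
  rw [e, map_add, inverse_apply_add_smul hV h0 h1]
  congr 1
  exact ((Ring.inverse (1 + r • V)).restrictScalars ℝ).map_smul _ _

theorem norm_inverse_apply_add_le {r : ℝ} (h0 : 0 ≤ r) (h1 : r < 1) (y : E) :
    ‖Ring.inverse (1 + r • V) (y + V y)‖ ≤ 2 * ‖y‖ := by
  rw [inverse_apply_add hV h0 h1]
  have h2 := norm_one_sub_smul_inverse_le hV h0 h1 (V y)
  rw [hV] at h2
  linarith [norm_add_le y ((1 - r) • Ring.inverse (1 + r • V) (V y))]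

variable {r : ℕ → ℝ} (hr0 : ∀ n, 0 ≤ r n) (hr1 : ∀ n, r n < 1) (hr : Tendsto r atTop (𝓝 1))
  (hd : Dense {x | ∃ y, x = y + V y})
include hr0 hr1 hr hd

theorem tendsto_one_sub_smul_inverse (z : E) :
    Tendsto (fun n => (1 - r n) • Ring.inverse (1 + r n • V) z) atTop (𝓝 0) := by
  refine tendsto_apply_zero_of_dense (fun n z => (1 - r n) • Ring.inverse (1 + r n • V) z)
    (fun n x y => ?_) hd ?_ z
  · rw [← smul_sub, ← map_sub]
    exact norm_one_sub_smul_inverse_le hV (hr0 n) (hr1 n) _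
  · rintro _ ⟨y, rfl⟩
    refine squeeze_zero_norm (a := fun n => (1 - r n) * (2 * ‖y‖)) (fun n => ?_) ?_
    · rw [norm_smul, Real.norm_of_nonneg (by linarith [hr1 n])]
      exact mul_le_mul_of_nonneg_left (norm_inverse_apply_add_le hV (hr0 n) (hr1 n) y)
        (by linarith [hr1 n])
    · simpa using (hr.const_sub 1).mul_const (2 * ‖y‖)

theorem tendsto_regularisedCayley (y : E) :
    Tendsto (fun n => regularisedCayley V (r n) (y + V y)) atTop (𝓝 (V y - y)) := by
  have h := (tendsto_one_sub_smul_inverse hV hr0 hr1 hr hd (V y)).const_smul (2 : ℝ)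
  have h2 := h.const_sub (V y - y)
  rw [smul_zero, sub_zero] at h2
  refine h2.congr fun n => ?_
  rw [regularisedCayley_apply, inverse_apply_add hV (hr0 n) (hr1 n)]
  module

omit hr0 hr1 hr

/-- An isometry `V` such that `1 + V` has dense range is the cogenerator of a strongly continuous
semigroup of isometries, with generator extending `(V - 1) (V + 1)⁻¹`. -/
theorem exists_isIsometric_of_cogenerator :
    ∃ W : C0Semigroup E, W.IsIsometric ∧ ∀ y, (y + V y, V y - y) ∈ W.generatorGraph := by
  let r : ℕ → ℝ := fun n => 1 - 1 / ((n : ℝ) + 1)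
  have hr0 : ∀ n, 0 ≤ r n := fun n => by
    have : 1 / ((n : ℝ) + 1) ≤ 1 := by
      rw [div_le_one (by positivity)]
      linarith [(Nat.cast_nonneg n : (0 : ℝ) ≤ n)]
    simp only [r]; linarith
  have hr1 : ∀ n, r n < 1 := fun n => by
    have : 0 < 1 / ((n : ℝ) + 1) := by positivity
    simp only [r]; linarith
  have hr : Tendsto r atTop (𝓝 1) := by
    simpa [r] using (tendsto_one_div_add_atTop_nhds_zero_nat (𝕜 := ℝ)).const_sub 1
  -- The graph of (V - 1)(V + 1)⁻¹ parametrised by y, so that injectivity of 1 + V need not be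
  -- known.
  let G : Submodule ℂ (E × E) := LinearMap.range
    ((LinearMap.id + (V : E →ₗ[ℂ] E)).prod ((V : E →ₗ[ℂ] E) - LinearMap.id))
  have hG : ∀ y, (y + V y, V y - y) ∈ G := fun y => ⟨y, rfl⟩
  have hGd : Dense {x : E | ∃ y, (x, y) ∈ G} := hd.mono <| by
    rintro _ ⟨y, rfl⟩
    exact ⟨_, hG y⟩
  obtain ⟨W, hW, hGW⟩ := exists_C0Semigroup_of_tendsto (fun n => regularisedCayley V (r n))
    (fun n => regularisedCayley_isDissipative hV (hr0 n) (hr1 n))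
    (fun m n => commute_regularisedCayley V _ _) G hGd (by
      rintro _ _ ⟨y, hy⟩
      obtain ⟨rfl, rfl⟩ := Prod.ext_iff.1 hy
      exact tendsto_regularisedCayley hV hr0 hr1 hr hd y)
  refine ⟨W, fun t x => ?_, fun y => hGW (hG y)⟩
  have hclosed : IsClosed {x : E | ‖W.toFun t x‖ = ‖x‖} :=
    isClosed_eq (W.toFun t).continuous.norm continuous_norm
  refine hclosed.closure_subset_iff.2 ?_ (hd x)
  rintro _ ⟨y, rfl⟩
  -- The squared norm has derivative -2(1 - r²)‖(1 + rV)⁻¹ exp(sB)(y + Vy)‖². The inverse commutes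
  -- with the exponential and has norm at most 2‖y‖ on y + Vy, hence the constant 8 = 2 · 2².
  have hlower : ∀ n, ‖y + V y‖ ^ 2 - 8 * t * ‖y‖ ^ 2 * (1 - r n ^ 2) ≤
      ‖NormedSpace.exp ((t : ℝ) • regularisedCayley V (r n)) (y + V y)‖ ^ 2 := by
    intro n
    set B := regularisedCayley V (r n)
    have hB : B.IsDissipative := regularisedCayley_isDissipative hV (hr0 n) (hr1 n)
    have hcomm : Commute (Ring.inverse (1 + r n • V)) B := by
      have h2 : Commute (Ring.inverse (1 + r n • V)) 2 := by
        exact_mod_cast (Nat.cast_commute 2 (Ring.inverse (1 + r n • V))).symm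
      exact (Commute.one_right _).sub_right (h2.mul_right (Commute.refl _))
    have hderiv : ∀ s ∈ interior (Set.Icc (0 : ℝ) t), -(8 * ‖y‖ ^ 2 * (1 - r n ^ 2)) ≤
        deriv (fun s : ℝ => ‖NormedSpace.exp (s • B) (y + V y)‖ ^ 2) s := by
      intro s hs
      rw [interior_Icc] at hs
      rw [(hasDerivAt_norm_sq_exp_smul B _ s).deriv,
        re_inner_regularisedCayley hV (hr0 n) (hr1 n)]
      have e : Ring.inverse (1 + r n • V) (NormedSpace.exp (s • B) (y + V y)) =
          NormedSpace.exp (s • B) (Ring.inverse (1 + r n • V) (y + V y)) :=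
        DFunLike.congr_fun ((hcomm.smul_right s).exp_right).eq (y + V y)
      have h1 := (hB.norm_exp_smul_le hs.1.le (Ring.inverse (1 + r n • V) (y + V y))).trans
        (norm_inverse_apply_add_le hV (hr0 n) (hr1 n) y)
      rw [← e] at h1
      have h2 := pow_le_pow_left₀ (norm_nonneg _) h1 2
      have h3 : 0 ≤ 1 - r n ^ 2 := by nlinarith [hr0 n, hr1 n]
      nlinarith [mul_le_mul_of_nonneg_left h2 h3]
    have hdiff : Differentiable ℝ (fun s : ℝ => ‖NormedSpace.exp (s • B) (y + V y)‖ ^ 2) :=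
      fun s => (hasDerivAt_norm_sq_exp_smul B _ s).differentiableAt
    have h := (convex_Icc (0 : ℝ) t).mul_sub_le_image_sub_of_le_deriv
      hdiff.continuous.continuousOn hdiff.differentiableOn hderiv 0 ⟨le_rfl, t.2⟩ t ⟨t.2, le_rfl⟩
      t.2
    simp only [zero_smul, NormedSpace.exp_zero, one_apply_eq_self, sub_zero] at h
    linarith
  have h1 : Tendsto (fun n => ‖y + V y‖ ^ 2 - 8 * t * ‖y‖ ^ 2 * (1 - r n ^ 2)) atTop
      (𝓝 (‖y + V y‖ ^ 2)) := by
    simpa using (((hr.pow 2).const_sub 1).const_mul (8 * t * ‖y‖ ^ 2)).const_sub (‖y + V y‖ ^ 2)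
  have h2 := le_of_tendsto_of_tendsto' h1 ((hW t (y + V y)).norm.pow 2) hlower
  refine le_antisymm ?_ ((sq_le_sq₀ (norm_nonneg _) (norm_nonneg _)).1 h2)
  exact le_of_tendsto (hW t (y + V y)).norm (Eventually.of_forall fun n =>
    (regularisedCayley_isDissipative hV (hr0 n) (hr1 n)).norm_exp_smul_le t.2 _)

end Cogenerator

/-! ### Skew relations, their Cayley transforms and gluing of isometries. -/

section SkewRelation

variable {E : Type*} [NormedAddCommGroup E] [InnerProductSpace ℂ E]

/-- A linear relation is skew if `Re ⟪u, v⟫ = 0` for all its pairs `(u, v)`. -/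
def IsSkewRelation (G : Submodule ℂ (E × E)) : Prop :=
  ∀ p ∈ G, (inner ℂ p.1 p.2).re = 0

/-- The range of `1 - A` for the linear relation `A` with graph `G`. -/
def subRange (G : Submodule ℂ (E × E)) : Submodule ℂ E :=
  G.map (LinearMap.fst ℂ E E - LinearMap.snd ℂ E E)

/-- The range of `1 + A` for the linear relation `A` with graph `G`. -/
def addRange (G : Submodule ℂ (E × E)) : Submodule ℂ E :=
  G.map (LinearMap.fst ℂ E E + LinearMap.snd ℂ E E)

theorem sub_mem_subRange {G : Submodule ℂ (E × E)} {p : E × E} (hp : p ∈ G) :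
    p.1 - p.2 ∈ subRange G := ⟨p, hp, rfl⟩

theorem add_mem_addRange {G : Submodule ℂ (E × E)} {p : E × E} (hp : p ∈ G) :
    p.1 + p.2 ∈ addRange G := ⟨p, hp, rfl⟩

namespace IsSkewRelation

variable {G : Submodule ℂ (E × E)} (hG : IsSkewRelation G)
include hG

theorem norm_sub_sq {p : E × E} (hp : p ∈ G) :
    ‖p.1 - p.2‖ ^ 2 = ‖p.1‖ ^ 2 + ‖p.2‖ ^ 2 := by
  have h := _root_.norm_sub_sq (𝕜 := ℂ) p.1 p.2
  rw [RCLike.re_to_complex, hG p hp] at h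
  linarith

theorem norm_add_eq_norm_sub {p : E × E} (hp : p ∈ G) : ‖p.1 + p.2‖ = ‖p.1 - p.2‖ := by
  have h := norm_add_sq (𝕜 := ℂ) p.1 p.2
  rw [RCLike.re_to_complex, hG p hp] at h
  have h2 := hG.norm_sub_sq hp
  exact (sq_eq_sq₀ (norm_nonneg _) (norm_nonneg _)).1 (by linarith)

/-- Makes (u, v) ↦ u - v bounded below on G: the Cayley transform is well defined, and closedness
passes from G to the range. -/
theorem norm_le_norm_sub {p : E × E} (hp : p ∈ G) : ‖p‖ ≤ ‖p.1 - p.2‖ := by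
  have h := hG.norm_sub_sq hp
  rw [Prod.norm_def, max_le_iff]
  constructor <;> refine (sq_le_sq₀ (norm_nonneg _) (norm_nonneg _)).1 ?_ <;>
    nlinarith [sq_nonneg ‖p.1‖, sq_nonneg ‖p.2‖]

/-- The Cayley transform of a skew relation, as an isometry defined on the range of `1 - A`. -/
theorem exists_cayley : ∃ J : subRange G →ₗᵢ[ℂ] E,
    ∀ (p : E × E) (hp : p ∈ G), J ⟨p.1 - p.2, sub_mem_subRange hp⟩ = p.1 + p.2 := by
  let f : G →ₗ[ℂ] subRange G :=
    (LinearMap.fst ℂ E E - LinearMap.snd ℂ E E).submoduleMap G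
  have hf : ∀ p : G, (f p : E) = p.1.1 - p.1.2 := fun p => rfl
  have hinj : Function.Injective f := by
    rw [injective_iff_map_eq_zero]
    intro p hp
    have h := hG.norm_le_norm_sub p.2
    rw [← hf, hp] at h
    simpa using h
  let e : G ≃ₗ[ℂ] subRange G := LinearEquiv.ofBijective f
    ⟨hinj, LinearMap.submoduleMap_surjective _ _⟩
  let J : subRange G →ₗ[ℂ] E :=
    (LinearMap.fst ℂ E E + LinearMap.snd ℂ E E) ∘ₗ G.subtype ∘ₗ e.symm.toLinearMap
  have hJ : ∀ p : G, J (e p) = p.1.1 + p.1.2 := fun p => by simp [J]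
  refine ⟨⟨J, fun x => ?_⟩, fun p hp => hJ ⟨p, hp⟩⟩
  obtain ⟨p, rfl⟩ := e.surjective x
  rw [hJ]
  exact hG.norm_add_eq_norm_sub p.2

theorem isClosed_subRange [CompleteSpace E] (hc : IsClosed (G : Set (E × E))) :
    IsClosed (subRange G : Set E) := by
  have : CompleteSpace G := hc.completeSpace_coe
  let f : G →L[ℂ] E := (ContinuousLinearMap.fst ℂ E E - ContinuousLinearMap.snd ℂ E E).comp
    G.subtypeL
  have hf : AntilipschitzWith 1 f := AddMonoidHomClass.antilipschitz_of_bound f fun p => by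
    rw [NNReal.coe_one, one_mul]
    exact hG.norm_le_norm_sub p.2
  have h := hf.isClosed_range f.uniformContinuous
  convert h using 1
  ext x
  simp [subRange, f]

end IsSkewRelation

/-- Glueing isometries on a subspace and on its orthogonal complement. -/
theorem exists_isometry_of_orthogonal (K : Submodule ℂ E) [K.HasOrthogonalProjection]
    (J : K →ₗᵢ[ℂ] E) (ι : Kᗮ →ₗᵢ[ℂ] E) (h : ∀ x y, inner ℂ (J x) (ι y) = 0) :
    ∃ V : E →L[ℂ] E, (∀ x, ‖V x‖ = ‖x‖) ∧ ∀ x : K, V x = J x := by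
  refine ⟨J.toContinuousLinearMap.comp K.orthogonalProjectionOnto +
    ι.toContinuousLinearMap.comp Kᗮ.orthogonalProjectionOnto, fun x => ?_, fun x => ?_⟩
  · have h1 := norm_add_sq_eq_norm_sq_add_norm_sq_of_inner_eq_zero _ _
      (h (K.orthogonalProjectionOnto x) (Kᗮ.orthogonalProjectionOnto x))
    have h2 := K.norm_sq_eq_add_norm_sq_projection x
    rw [J.norm_map, ι.norm_map] at h1
    refine (sq_eq_sq₀ (norm_nonneg _) (norm_nonneg _)).1 ?_
    simp only [add_apply, ContinuousLinearMap.comp_apply, LinearIsometry.coe_toContinuousLinearMap]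
    rw [h2, sq, h1]
    ring
  · simp [Submodule.orthogonalProjectionOnto_orthogonal_apply_eq_zero]

/-- There is a linear isometry between finite-dimensional spaces when the dimensions allow it. -/
theorem exists_linearIsometry_of_finrank_le {F F' : Type*} [NormedAddCommGroup F]
    [InnerProductSpace ℂ F] [FiniteDimensional ℂ F] [NormedAddCommGroup F']
    [InnerProductSpace ℂ F'] [FiniteDimensional ℂ F']
    (h : Module.finrank ℂ F ≤ Module.finrank ℂ F') : Nonempty (F →ₗᵢ[ℂ] F') := by
  let b := stdOrthonormalBasis ℂ F
  let b' := stdOrthonormalBasis ℂ F'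
  let f : F →ₗ[ℂ] F' := b.toBasis.constr ℂ (b' ∘ Fin.castLE h)
  refine ⟨f.isometryOfOrthonormal (v := b.toBasis) (by simp) ?_⟩
  have e : f ∘ b.toBasis = b' ∘ Fin.castLE h := funext fun i => b.toBasis.constr_basis ℂ _ i
  rw [e]
  exact b'.orthonormal.comp _ (Fin.castLE_injective h)

end SkewRelation

/-! ### Defect spaces as orthogonal complements of ranges. -/

namespace UnboundedOperator

variable {E : Type*} [NormedAddCommGroup E] [InnerProductSpace ℂ E]

theorem mem_graph_I_smul {H : E →ₗ.[ℂ] E} {p : E × E} :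
    p ∈ (Complex.I • H).graph ↔ ∃ u : H.domain, p = ((u : E), Complex.I • H u) := by
  rw [LinearPMap.mem_graph_iff]
  constructor
  · rintro ⟨u, h1, h2⟩
    exact ⟨u, Prod.ext h1.symm h2.symm⟩
  · rintro ⟨u, rfl⟩
    exact ⟨u, rfl, rfl⟩

theorem IsSymmetric.isSkewRelation {H : E →ₗ.[ℂ] E} (hH : IsSymmetric H) :
    IsSkewRelation (Complex.I • H).graph := by
  intro p hp
  obtain ⟨u, rfl⟩ := mem_graph_I_smul.1 hp
  have h := hH.2 u u
  rw [← inner_conj_symm, Complex.conj_eq_iff_im] at h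
  simp [h]

theorem isClosed_graph_I_smul {H : E →ₗ.[ℂ] E} (hH : H.IsClosed) :
    IsClosed ((Complex.I • H).graph : Set (E × E)) := by
  have h : ((Complex.I • H).graph : Set (E × E)) =
      (fun p : E × E => (p.1, (-Complex.I) • p.2)) ⁻¹' (H.graph : Set (E × E)) := by
    ext p
    rw [SetLike.mem_coe, mem_graph_I_smul, Set.mem_preimage, SetLike.mem_coe,
      LinearPMap.mem_graph_iff]
    constructor
    · rintro ⟨u, rfl⟩
      exact ⟨u, rfl, by simp [smul_smul]⟩
    · rintro ⟨u, h1, h2⟩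
      exact ⟨u, Prod.ext h1.symm (by simp [h2, smul_smul])⟩
  rw [h]
  exact IsClosed.preimage (by fun_prop) hH

variable [CompleteSpace E]

/-- The weak form of H*y = zy; the identity itself forces y into dom H*. -/
theorem mem_adjointEigenspace_iff {H : E →ₗ.[ℂ] E} (hH : Dense (H.domain : Set E)) (z : ℂ)
    (y : E) : y ∈ adjointEigenspace H z ↔
      ∀ u : H.domain, inner ℂ (H u) y = z * inner ℂ (u : E) y := by
  have key : ∀ u : H.domain, inner ℂ (H u) y = z * inner ℂ (u : E) y ↔
      inner ℂ (z • y) (u : E) = inner ℂ y (H u) := fun u => by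
    rw [← inner_smul_right, ← inner_conj_symm (H u), ← inner_conj_symm (u : E),
      (starRingEnd ℂ).injective.eq_iff, eq_comm]
  simp only [key]
  constructor
  · rintro ⟨w, hw, rfl⟩ u
    have hw' : z • (w : E) = H.adjoint w := sub_eq_zero.1 hw
    change inner ℂ (z • (w : E)) (u : E) = inner ℂ (w : E) (H u)
    rw [hw']
    exact LinearPMap.adjoint_isFormalAdjoint hH w u
  · intro h
    have hy : y ∈ H.adjoint.domain := LinearPMap.mem_adjoint_domain_of_exists y ⟨z • y, h⟩
    refine ⟨⟨y, hy⟩, ?_, rfl⟩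
    exact sub_eq_zero.2 (LinearPMap.adjoint_apply_eq hH ⟨y, hy⟩ h).symm

/-- The inner product is conjugate-linear on the left, so ⟪u - iHu, y⟫ = ⟪u, y⟫ + i⟪Hu, y⟫, which
vanishes iff ⟪Hu, y⟫ = i⟪u, y⟫. -/
theorem defectSpacePlus_eq {H : E →ₗ.[ℂ] E} (hH : Dense (H.domain : Set E)) :
    defectSpacePlus H = (subRange (Complex.I • H).graph)ᗮ := by
  ext y
  rw [defectSpacePlus, mem_adjointEigenspace_iff hH, Submodule.mem_orthogonal]
  have key : ∀ u : H.domain, inner ℂ ((u : E) - Complex.I • H u) y = 0 ↔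
      inner ℂ (H u) y = Complex.I * inner ℂ (u : E) y := fun u => by
    rw [inner_sub_left, inner_smul_left, Complex.conj_I]
    constructor <;> intro h
    · linear_combination (-Complex.I) * h + (inner ℂ (H u) y) * Complex.I_mul_I
    · linear_combination Complex.I * h + (inner ℂ (u : E) y) * Complex.I_mul_I
  constructor
  · rintro h _ ⟨p, hp, rfl⟩
    obtain ⟨u, rfl⟩ := mem_graph_I_smul.1 hp
    exact (key u).2 (h u)
  · intro h u
    exact (key u).1 (h _ (sub_mem_subRange (mem_graph_I_smul.2 ⟨u, rfl⟩)))

theorem defectSpaceMinus_eq {H : E →ₗ.[ℂ] E} (hH : Dense (H.domain : Set E)) :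
    defectSpaceMinus H = (addRange (Complex.I • H).graph)ᗮ := by
  ext y
  rw [defectSpaceMinus, mem_adjointEigenspace_iff hH, Submodule.mem_orthogonal]
  have key : ∀ u : H.domain, inner ℂ ((u : E) + Complex.I • H u) y = 0 ↔
      inner ℂ (H u) y = -Complex.I * inner ℂ (u : E) y := fun u => by
    rw [inner_add_left, inner_smul_left, Complex.conj_I]
    constructor <;> intro h
    · linear_combination Complex.I * h + (inner ℂ (H u) y) * Complex.I_mul_I
    · linear_combination (-Complex.I) * h + (inner ℂ (u : E) y) * Complex.I_mul_I
  constructor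
  · rintro h _ ⟨p, hp, rfl⟩
    obtain ⟨u, rfl⟩ := mem_graph_I_smul.1 hp
    exact (key u).2 (h u)
  · intro h u
    exact (key u).1 (h _ (add_mem_addRange (mem_graph_I_smul.2 ⟨u, rfl⟩)))

end UnboundedOperator

/-! ### Generators of isometric semigroups and their cogenerators. -/

namespace C0Semigroup

variable {E : Type*} [NormedAddCommGroup E] [InnerProductSpace ℂ E]

theorem graph_generator (W : C0Semigroup E) : W.generator.graph = W.generatorGraph := by
  ext ⟨x, y⟩
  exact W.mem_graph_generator_iff x y

/-- The preimage under 1 - A, for A the generator, is the truncated Laplace integral S = ∫₀¹ e⁻ˢ Wₛx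
ds. Stopping at 1 avoids improper integrals at the cost of the term e⁻¹W₁x. -/
theorem sub_mem_subRange_generatorGraph [CompleteSpace E] (W : C0Semigroup E) (x : E) :
    x - Real.exp (-1) • W.toFun 1 x ∈ subRange W.generatorGraph := by
  let g : ℝ → E := fun s => Real.exp (-s) • W.toFun s.toNNReal x
  have hg : Continuous g := (Real.continuous_exp.comp continuous_neg).smul
    ((W.strongly_continuous x).comp continuous_real_toNNReal)
  set S : E := ∫ s in (0 : ℝ)..1, g s with hS
  -- `Φ` extends h ↦ W_h S to all real h (`g` is e⁻ˢx for s < 0), so a two-sided derivative is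
  -- available; Φ'(0) is the generator at S.
  let Φ : ℝ → E := fun h => Real.exp h • ∫ s in (h)..(1 + h), g s
  have hΦ0 : Φ 0 = S := by simp [Φ, hS]
  have hΦ : HasDerivAt Φ (g 1 - g 0 + S) 0 := by
    have hP : ∀ a, HasDerivAt (fun h => ∫ s in (0 : ℝ)..h, g s) (g a) a := fun a =>
      hg.integral_hasStrictDerivAt 0 a |>.hasDerivAt
    have h1 : HasDerivAt (fun h : ℝ => ∫ s in (0 : ℝ)..(1 + h), g s) (g 1) 0 := by
      have := (hP (1 + 0)).comp_const_add 1 0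
      simpa using this
    have h2 : HasDerivAt (fun h : ℝ => ∫ s in (h)..(1 + h), g s) (g 1 - g 0) 0 := by
      refine (h1.fun_sub (hP 0)).congr_of_eventuallyEq (Eventually.of_forall fun h => ?_)
      exact (intervalIntegral.integral_interval_sub_left (hg.intervalIntegrable _ _)
        (hg.intervalIntegrable _ _)).symm
    have h3 := (Real.hasDerivAt_exp 0).fun_smul h2
    simpa [hS] using h3
  have hWS : ∀ t : ℝ≥0, W.toFun t S = Φ t := by
    intro t
    rw [hS, ← ContinuousLinearMap.intervalIntegral_comp_comm _ (hg.intervalIntegrable _ _)]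
    have e : ∀ s ∈ Set.uIcc (0 : ℝ) 1, W.toFun t (g s) = Real.exp t • g (s + t) := by
      intro s hs
      rw [Set.uIcc_of_le zero_le_one] at hs
      simp only [g]
      rw [Real.toNNReal_add hs.1 t.coe_nonneg, Real.toNNReal_coe, add_comm s.toNNReal, W.map_add,
        smul_smul, ← Real.exp_add, ContinuousLinearMap.comp_apply,
        ← Complex.coe_smul, ← Complex.coe_smul, map_smul]
      congr 3
      ring
    rw [intervalIntegral.integral_congr e, intervalIntegral.integral_smul,
      intervalIntegral.integral_comp_add_right (fun s => g s), zero_add]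
  refine ⟨(S, g 1 - g 0 + S), ?_, ?_⟩
  · change Tendsto (fun t : ℝ≥0 => (((t : ℝ) : ℂ)⁻¹) • (W.toFun t S - S)) (𝓝[>] 0) (𝓝 _)
    have h1 := hasDerivAt_iff_tendsto_slope_zero.1 hΦ
    have h2 : Tendsto (fun t : ℝ≥0 => (t : ℝ)) (𝓝[>] 0) (𝓝[≠] 0) := by
      refine tendsto_nhdsWithin_iff.2 ⟨(NNReal.continuous_coe.tendsto' 0 0
        NNReal.coe_zero).mono_left nhdsWithin_le_nhds, ?_⟩
      filter_upwards [self_mem_nhdsWithin] with t ht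
      have : (0 : ℝ) < t := ht
      exact this.ne'
    refine (h1.comp h2).congr fun t => ?_
    simp only [Function.comp_apply, zero_add, hWS, hΦ0]
    rw [← Complex.ofReal_inv, Complex.coe_smul]
  · have h0 : g 0 = x := by simp [g, W.map_zero]
    have h1 : g 1 = Real.exp (-1) • W.toFun 1 x := by simp [g]
    simp [h0, h1]

namespace IsIsometric

variable {W : C0Semigroup E} (hW : W.IsIsometric)
include hW

/-- Expand ‖W_t u‖² = ‖u‖² with W_t u = u + t d(t), divide by t and let t → 0. -/
theorem isSkewRelation : IsSkewRelation W.generatorGraph := by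
  rintro ⟨u, v⟩ hp
  change Tendsto (fun t : ℝ≥0 => (((t : ℝ) : ℂ)⁻¹) • (W.toFun t u - u)) (𝓝[>] 0) (𝓝 v) at hp
  set d : ℝ≥0 → E := fun t => (((t : ℝ) : ℂ)⁻¹) • (W.toFun t u - u) with hd
  have ht : Tendsto (fun t : ℝ≥0 => (t : ℝ)) (𝓝[>] 0) (𝓝 0) :=
    (NNReal.continuous_coe.tendsto' 0 0 NNReal.coe_zero).mono_left nhdsWithin_le_nhds
  have h1 : Tendsto (fun t : ℝ≥0 => 2 * (inner ℂ u (d t)).re + t * ‖d t‖ ^ 2) (𝓝[>] 0)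
      (𝓝 (2 * (inner ℂ u v).re + 0 * ‖v‖ ^ 2)) :=
    ((Complex.continuous_re.tendsto _).comp (tendsto_const_nhds.inner hp) |>.const_mul 2).add
      (ht.mul (hp.norm.pow 2))
  have h2 : (fun t : ℝ≥0 => 2 * (inner ℂ u (d t)).re + t * ‖d t‖ ^ 2) =ᶠ[𝓝[>] 0] fun _ => 0 := by
    filter_upwards [self_mem_nhdsWithin] with t ht0
    have ht0 : (0 : ℝ) < t := ht0
    have htC : ((t : ℝ) : ℂ) ≠ 0 := by exact_mod_cast ht0.ne'
    have e : W.toFun t u = u + ((t : ℝ) : ℂ) • d t := by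
      simp [hd, smul_smul, htC]
    have h := norm_add_sq (𝕜 := ℂ) u (((t : ℝ) : ℂ) • d t)
    rw [← e, hW t u, inner_smul_right, RCLike.re_to_complex, Complex.re_ofReal_mul, norm_smul,
      Complex.norm_real, Real.norm_of_nonneg ht0.le] at h
    have h3 : (t : ℝ) * (2 * (inner ℂ u (d t)).re + t * ‖d t‖ ^ 2) = 0 := by linarith
    exact (mul_eq_zero.1 h3).resolve_left ht0.ne'
  have h3 := tendsto_nhds_unique (h1.congr' h2) tendsto_const_nhds
  change (inner ℂ u v).re = 0
  linarith

variable [CompleteSpace E]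

/-- Since ‖e⁻¹W₁‖ < 1, the operator 1 - e⁻¹W₁ is invertible, and its range lies in that of 1 minus
the generator. -/
theorem subRange_generatorGraph : subRange W.generatorGraph = ⊤ := by
  rw [Submodule.eq_top_iff']
  intro y
  have hn : ‖Real.exp (-1) • W.toFun 1‖ < 1 := by
    have h1 : ‖W.toFun 1‖ ≤ 1 := (W.toFun 1).opNorm_le_bound zero_le_one fun x => by
      rw [hW, one_mul]
    have h2 : Real.exp (-1) < 1 := by
      rw [← Real.exp_zero]
      exact Real.exp_lt_exp.2 (by norm_num)
    rw [norm_smul, Real.norm_of_nonneg (Real.exp_pos _).le]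
    nlinarith [norm_nonneg (W.toFun 1), Real.exp_pos (-1)]
  have h := DFunLike.congr_fun (Ring.mul_inverse_cancel _ (isUnit_one_sub_of_norm_lt_one hn)) y
  have h2 := W.sub_mem_subRange_generatorGraph
    (Ring.inverse (1 - Real.exp (-1) • W.toFun 1) y)
  have h3 : y = Ring.inverse (1 - Real.exp (-1) • W.toFun 1) y -
      Real.exp (-1) • W.toFun 1 (Ring.inverse (1 - Real.exp (-1) • W.toFun 1) y) := by
    simpa using h.symm
  rwa [h3]

/-- The cogenerator of a strongly continuous semigroup of isometries. -/
theorem exists_cogenerator : ∃ J : E →ₗᵢ[ℂ] E,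
    ∀ p ∈ W.generatorGraph, J (p.1 - p.2) = p.1 + p.2 := by
  obtain ⟨J, hJ⟩ := hW.isSkewRelation.exists_cayley
  have h : ∀ x : E, x ∈ subRange W.generatorGraph := fun x => by
    simp [hW.subRange_generatorGraph]
  exact ⟨⟨J.toLinearMap ∘ₗ LinearMap.id.codRestrict _ h, fun x => J.norm_map ⟨x, h x⟩⟩, hJ⟩

end IsIsometric

end C0Semigroup

/-! ### The two directions of the index criterion. -/

namespace UnboundedOperator

variable {E : Type*} [NormedAddCommGroup E] [InnerProductSpace ℂ E] [CompleteSpace E]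

theorem IsSymmetric.exists_isIsometric_of_finrank_le {H : E →ₗ.[ℂ] E} (hH : IsSymmetric H)
    (hclosed : H.IsClosed) [FiniteDimensional ℂ (defectSpacePlus H)]
    [FiniteDimensional ℂ (defectSpaceMinus H)]
    (h : Module.finrank ℂ (defectSpacePlus H) ≤ Module.finrank ℂ (defectSpaceMinus H)) :
    ∃ W : C0Semigroup E, W.IsIsometric ∧ Complex.I • H ≤ W.generator := by
  set G := (Complex.I • H).graph with hGdef
  have hskew : IsSkewRelation G := hH.isSkewRelation
  have : CompleteSpace (subRange G) :=
    (hskew.isClosed_subRange (isClosed_graph_I_smul hclosed)).completeSpace_coe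
  obtain ⟨J, hJ⟩ := hskew.exists_cayley
  obtain ⟨ι⟩ := exists_linearIsometry_of_finrank_le h
  let ι' : (subRange G)ᗮ →ₗᵢ[ℂ] E := (defectSpaceMinus H).subtypeₗᵢ.comp
    (ι.comp (LinearIsometryEquiv.ofEq _ _ (defectSpacePlus_eq hH.1).symm).toLinearIsometry)
  -- `J` takes values in ran(1 + iH), and `ι'` in its orthogonal complement N₋.
  obtain ⟨V, hV, hVJ⟩ := exists_isometry_of_orthogonal (subRange G) J ι' (by
    rintro ⟨_, p, hp, rfl⟩ y
    have e := hJ p hp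
    have hy : ι' y ∈ (addRange G)ᗮ := by
      rw [← defectSpaceMinus_eq hH.1]
      exact Submodule.coe_mem _
    have h := (Submodule.mem_orthogonal _ _).1 hy _ (add_mem_addRange hp)
    rw [← e] at h
    exact h)
  have hVG : ∀ p ∈ G, V (p.1 - p.2) = p.1 + p.2 := fun p hp =>
    (hVJ ⟨_, sub_mem_subRange hp⟩).trans (hJ p hp)
  -- The parameter y = (u - iHu)/2 recovers u as y + Vy and iHu as Vy - y.
  have hfst : ∀ p ∈ G, (2⁻¹ : ℂ) • (p.1 - p.2) + V ((2⁻¹ : ℂ) • (p.1 - p.2)) = p.1 := by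
    intro p hp
    rw [map_smul, hVG p hp]
    module
  have hsnd : ∀ p ∈ G, V ((2⁻¹ : ℂ) • (p.1 - p.2)) - (2⁻¹ : ℂ) • (p.1 - p.2) = p.2 := by
    intro p hp
    rw [map_smul, hVG p hp]
    module
  have hd : Dense {x | ∃ y, x = y + V y} := hH.1.mono fun u hu =>
    ⟨_, (hfst (u, Complex.I • H ⟨u, hu⟩) (mem_graph_I_smul.2 ⟨⟨u, hu⟩, rfl⟩)).symm⟩
  obtain ⟨W, hW, hWV⟩ := exists_isIsometric_of_cogenerator hV hd
  refine ⟨W, hW, LinearPMap.le_of_le_graph ?_⟩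
  rw [W.graph_generator]
  intro p hp
  have h := hWV ((2⁻¹ : ℂ) • (p.1 - p.2))
  rwa [hfst p hp, hsnd p hp] at h

/-- The cogenerator J preserves inner products and carries ran(1 - iH) onto ran(1 + iH), hence
vectors orthogonal to the first to vectors orthogonal to the second. -/
theorem rank_defectSpacePlus_le {H : E →ₗ.[ℂ] E} (hH : Dense (H.domain : Set E))
    {W : C0Semigroup E} (hW : W.IsIsometric) (hHW : Complex.I • H ≤ W.generator) :
    Module.rank ℂ (defectSpacePlus H) ≤ Module.rank ℂ (defectSpaceMinus H) := by
  obtain ⟨J, hJ⟩ := hW.exists_cogenerator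
  have hG : (Complex.I • H).graph ≤ W.generatorGraph := by
    rw [← W.graph_generator]
    exact LinearPMap.le_graph_of_le hHW
  have hmaps : ∀ y ∈ defectSpacePlus H, J.toLinearMap y ∈ defectSpaceMinus H := by
    intro y hy
    rw [defectSpacePlus_eq hH, Submodule.mem_orthogonal] at hy
    rw [defectSpaceMinus_eq hH, Submodule.mem_orthogonal]
    rintro _ ⟨p, hp, rfl⟩
    change inner ℂ (p.1 + p.2) (J y) = 0
    rw [← hJ p (hG hp), J.inner_map_map]
    exact hy _ (sub_mem_subRange hp)
  refine LinearMap.rank_le_of_injective (J.toLinearMap.restrict hmaps) fun a b hab => ?_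
  exact Subtype.ext (J.injective (congrArg Subtype.val hab))

end UnboundedOperator

theorem proposition4p5 {E : Type*} [NormedAddCommGroup E] [InnerProductSpace ℂ E]
    [CompleteSpace E] (H : E →ₗ.[ℂ] E) (hsymm : UnboundedOperator.IsSymmetric H)
    (hclosed : H.IsClosed) (nPlus nMinus : ℕ)
    (hdef : UnboundedOperator.HasFiniteDefectIndices H nPlus nMinus) :
    (nPlus ≤ nMinus →
      ∃ W : C0Semigroup E, W.IsIsometric ∧ Complex.I • H ≤ W.generator) ∧
    (nMinus < nPlus →
      ¬ ∃ W : C0Semigroup E, W.IsIsometric ∧ Complex.I • H ≤ W.generator) := by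
  obtain ⟨hp, hm⟩ := hdef
  refine ⟨fun h => ?_, ?_⟩
  · have := Module.finite_of_rank_eq_nat hp
    have := Module.finite_of_rank_eq_nat hm
    refine hsymm.exists_isIsometric_of_finrank_le hclosed ?_
    rwa [Module.finrank_eq_of_rank_eq hp, Module.finrank_eq_of_rank_eq hm]
  · rintro h ⟨W, hW, hHW⟩
    have hle := UnboundedOperator.rank_defectSpacePlus_le hsymm.1 hW hHW
    rw [hp, hm] at hle
    exact absurd (Nat.cast_le.1 hle) (not_le.2 h)
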